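/- Let $X$ be the compact abelian group of all arrays $a:\mathbf Z^2\to\mathbf Z/2$ with $$a(z)+a(z+e_1)+a(z+e_2)=0\qquad\text{for all } z\in\mathbf Z^2,$$ where $e_1=(1,0)$, $e_2=(0,1)$, under termwise addition and with the product topology. Let $\mu$ be its Haar measure with $\mu(X)=1$. Let $S$ and $T$ be the shifts of $X$ given by $$(Sa)(z)=a(z-e_2),\qquad (Ta)(z)=a(z-e_1),$$ and put $n_m=2^m$ for $m=0,1,2,\dots$. Below, $S^kA$ and $T^kA$ denote the images of $A$ under $S^k$ and $T^k$, for $k\in\mathbf Z$. Then: 1. $S$ and $T$ commute and preserve $\mu$, and the $\mathbf Z^2$-action generated by them is mixing: for all measurable $A,B\subset X$, $\mu(A\cap S^kT^lB)\to\mu(A)\mu(B)$ as $(k,l)\to\infty$ in $\mathbf Z^2$. 2. The action is 3-fold mixing along the pair of sequences $(-n_m,0)$, $(0,-n_m)$: for all measurable $A,B,C\subset X$, $$\lim_{m\to\infty}\mu(A\cap S^{-n_m}B\cap T^{-n_m}C)=\mu(A)\mu(B)\mu(C);$$ in particular, for every measurable $A\subset X$, $$\lim_{m\to\infty}\mu(A\cap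 S^{-n_m}A\cap T^{-n_m}A)=\mu(A)^3.$$ 3. There is a measurable set $A_0\subset X$ with $\mu(A_0)=\frac12$ such that, for all $m\ge 0$, $$\mu(A_0\cap S^{n_m}A_0\cap T^{n_m}A_0)=0.$$ Consequently the inverse action, generated by $S^{-1}$ and $T^{-1}$, lacks the property in 2: it is not true that $\mu(A\cap (S^{-1})^{-n_m}A\cap (T^{-1})^{-n_m}A)\to\mu(A)^3$ for all measurable $A$. -/

import Mathlib

open MeasureTheory Filter Topology

namespace Ledrappier

/-- The compact group of all arrays `a : ℤ² → ℤ/2` with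
`a (z₁, z₂) + a (z₁ + 1, z₂) + a (z₁, z₂ + 1) = 0` for all `z`, under termwise addition mod 2.
As a subspace of the product it carries the product topology and the Borel σ-algebra. -/
def X : AddSubgroup (ℤ × ℤ → ZMod 2) where
  carrier := {a | ∀ i j : ℤ, a (i, j) + a (i + 1, j) + a (i, j + 1) = 0}
  zero_mem' := by intro i j; simp
  add_mem' := by
    intro a b ha hb i j
    have h : (a + b) (i, j) + (a + b) (i + 1, j) + (a + b) (i, j + 1)
        = (a (i, j) + a (i + 1, j) + a (i, j + 1))
          + (b (i, j) + b (i + 1, j) + b (i, j + 1)) := by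
      simp only [Pi.add_apply]; ring
    rw [h, ha i j, hb i j, add_zero]
  neg_mem' := by
    intro a ha i j
    have h : (-a) (i, j) + (-a) (i + 1, j) + (-a) (i, j + 1)
        = -(a (i, j) + a (i + 1, j) + a (i, j + 1)) := by
      simp only [Pi.neg_apply]; ring
    rw [h, ha i j, neg_zero]

theorem isClosed_X : IsClosed (X : Set (ℤ × ℤ → ZMod 2)) := by
  have h : (X : Set (ℤ × ℤ → ZMod 2))
      = ⋂ i : ℤ, ⋂ j : ℤ, {a | a (i, j) + a (i + 1, j) + a (i, j + 1) = 0} := by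
    ext a
    simp only [Set.mem_iInter, Set.mem_ofPred_eq]
    rfl
  rw [h]
  exact isClosed_iInter fun i => isClosed_iInter fun j =>
    isClosed_eq (by fun_prop) continuous_const

instance : CompactSpace X := isCompact_iff_compactSpace.mp isClosed_X.isCompact

/-- Haar measure on the compact group `X`, normalized to total mass `1`. -/
noncomputable def μ : Measure X := Measure.addHaarMeasure ⊤

/-- Translation of the array by the vector `(k, l)`: the point `z` of the new array carries
the entry of the old one at `z - (k, l)`. -/
def translate (k l : ℤ) : X ≃ₜ X where
  toFun a := ⟨fun z => a.1 (z.1 - k, z.2 - l), fun i j => by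
    have h := a.2 (i - k) (j - l)
    rwa [sub_add_eq_add_sub, sub_add_eq_add_sub] at h⟩
  invFun a := ⟨fun z => a.1 (z.1 + k, z.2 + l), fun i j => by
    have h := a.2 (i + k) (j + l)
    rwa [add_right_comm i, add_right_comm j] at h⟩
  left_inv a := by ext z; simp
  right_inv a := by ext z; simp
  continuous_toFun := Continuous.subtype_mk (continuous_pi fun z =>
    (continuous_apply (z.1 - k, z.2 - l)).comp continuous_subtype_val) _
  continuous_invFun := Continuous.subtype_mk (continuous_pi fun z =>
    (continuous_apply (z.1 + k, z.2 + l)).comp continuous_subtype_val) _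

/-- The vertical shift `(S a) (z₁, z₂) = a (z₁, z₂ - 1)`. -/
def S : X ≃ₜ X := translate 0 1

/-- The horizontal shift `(T a) (z₁, z₂) = a (z₁ - 1, z₂)`. -/
def T : X ≃ₜ X := translate 1 0

/-- Two commuting invertible transformations `U`, `V` generate a mixing `ℤ²`-action:
`μ (A ∩ U^k V^l B) → μ A * μ B` as `(k, l) → ∞` in `ℤ²`, for all measurable `A`, `B`. -/
def IsMixingAction {Ω : Type*} [TopologicalSpace Ω] [MeasurableSpace Ω] (ν : Measure Ω)
    (U V : Ω ≃ₜ Ω) : Prop :=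
  ∀ A B : Set Ω, MeasurableSet A → MeasurableSet B →
    Tendsto (fun g : ℤ × ℤ => ν (A ∩ (U ^ g.1 * V ^ g.2) '' B)) cofinite (𝓝 (ν A * ν B))

end Ledrappier

open Ledrappier

namespace Ledrappier

/-! ### The shift action -/

/-! A finite pattern `p` of points of `ℤ²` is a Laurent polynomial over `ℤ/2` and defines a
character of `X`. Substituting `x = t`, `y = 1 + t` kills the defining relation, and `p` annihilates
`X` exactly when its value `ev p` in the field `ℤ/2(t)` vanishes (`forall_pairing_eq_zero_iff`);
otherwise its character integrates to `0`. Moving `p` by `v` multiplies `ev p` by `mono v`. Hence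
joint mixing along vectors `v i j` follows once every nonzero family `P` satisfies `∑ j, mono (v i
j) * P j ≠ 0` eventually (`tendsto_measure_iInter`).

For two shifts this holds because `mono` is injective. For the triple, put `q = t ^ 2 ^ m`, so that
`(1 + t) ^ 2 ^ m = 1 + q`. In the negative direction a relation `P 0 + P 1 / (1 + q) + P 2 / q = 0`
becomes, without denominators, a base-`q` expansion whose digits do not depend on `m`, so for large
`m` all digits vanish. In the positive direction `1 + q + (1 + q) = 0` is a relation for every `m`;
it forbids three entries `1` at the corresponding places. -/

theorem translate_apply (k l : ℤ) (a : X) (z : ℤ × ℤ) :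
    (translate k l a).1 z = a.1 (z.1 - k, z.2 - l) := rfl

theorem translate_mul (k l k' l' : ℤ) :
    translate k l * translate k' l' = translate (k + k') (l + l') := by
  ext a z
  change a.1 (z.1 - k - k', z.2 - l - l') = a.1 (z.1 - (k + k'), z.2 - (l + l'))
  rw [sub_sub, sub_sub]

theorem translate_zero : translate 0 0 = 1 := by
  ext a z
  change a.1 (z.1 - 0, z.2 - 0) = a.1 z
  simp

theorem translate_inv (k l : ℤ) : (translate k l)⁻¹ = translate (-k) (-l) := by
  rw [inv_eq_iff_mul_eq_one, translate_mul, add_neg_cancel, add_neg_cancel, translate_zero]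

/-- The shifts as a homomorphism from `ℤ²`. -/
noncomputable def translateHom : Multiplicative (ℤ × ℤ) →* (X ≃ₜ X) where
  toFun v := translate v.toAdd.1 v.toAdd.2
  map_one' := translate_zero
  map_mul' _ _ := (translate_mul _ _ _ _).symm

theorem translate_zpow (k l n : ℤ) : translate k l ^ n = translate (n * k) (n * l) := by
  have h := map_zpow translateHom (Multiplicative.ofAdd (k, l)) n
  rw [← ofAdd_zsmul] at h
  simpa [translateHom] using h.symm

theorem S_zpow (n : ℤ) : S ^ n = translate 0 n := by
  rw [S, translate_zpow, mul_zero, mul_one]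

theorem T_zpow (n : ℤ) : T ^ n = translate n 0 := by
  rw [T, translate_zpow, mul_zero, mul_one]

theorem translate_image (k l : ℤ) (A : Set X) :
    translate k l '' A = translate (-k) (-l) ⁻¹' A := by
  rw [← translate_inv]
  exact (translate k l).image_eq_preimage_symm A

instance : BorelSpace (ZMod 2) := ⟨borel_eq_top_of_discrete.symm⟩

instance : μ.IsAddHaarMeasure := by unfold μ; infer_instance

instance : IsProbabilityMeasure μ := ⟨Measure.addHaarMeasure_self⟩

theorem measurePreserving_translate (k l : ℤ) : MeasurePreserving (translate k l) μ μ :=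
  AddMonoidHom.measurePreserving
    (f := { toFun := translate k l, map_zero' := rfl, map_add' := fun _ _ => rfl })
    (translate k l).continuous (translate k l).surjective rfl

/-! ### Finitely supported characters -/

/-- The two-element multiplicative character of `ℤ/2`. -/
noncomputable def sign (c : ZMod 2) : ℝ := if c = 0 then 1 else -1

theorem sign_zero : sign 0 = 1 := if_pos rfl

theorem sign_one : sign 1 = -1 := if_neg (by decide)

theorem sign_add (c d : ZMod 2) : sign (c + d) = sign c * sign d := by
  have h : ∀ c : ZMod 2, c = 0 ∨ c = 1 := by decide
  have h2 : (1 + 1 : ZMod 2) = 0 := rfl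
  rcases h c with rfl | rfl <;> rcases h d with rfl | rfl <;> simp [sign_zero, sign_one, h2]

/-- The mod 2 sum of the entries of `a` over the finite pattern `p`. -/
noncomputable def pairing (p : ℤ × ℤ →₀ ZMod 2) (a : X) : ZMod 2 :=
  Finsupp.linearCombination (ZMod 2) a.1 p

/-- The character of `X` given by a finite pattern. -/
noncomputable def char (p : ℤ × ℤ →₀ ZMod 2) (a : X) : ℝ := sign (pairing p a)

theorem pairing_add_left (p q : ℤ × ℤ →₀ ZMod 2) (a : X) :
    pairing (p + q) a = pairing p a + pairing q a := map_add _ _ _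

theorem pairing_add_right (p : ℤ × ℤ →₀ ZMod 2) (a b : X) :
    pairing p (a + b) = pairing p a + pairing p b := by
  simp [pairing, Finsupp.linearCombination_apply, Finsupp.sum, mul_add, Finset.sum_add_distrib]

theorem pairing_single (z : ℤ × ℤ) (a : X) : pairing (Finsupp.single z 1) a = a.1 z := by
  simp [pairing]

theorem char_zero (a : X) : char 0 a = 1 := by
  rw [char, pairing, map_zero, sign_zero]

theorem char_add (p q : ℤ × ℤ →₀ ZMod 2) (a : X) : char (p + q) a = char p a * char q a := by
  rw [char, pairing_add_left, sign_add]; rfl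

theorem char_sum {κ : Type*} (s : Finset κ) (p : κ → ℤ × ℤ →₀ ZMod 2) (a : X) :
    char (∑ j ∈ s, p j) a = ∏ j ∈ s, char (p j) a := by
  classical
  induction s using Finset.induction_on with
  | empty => simp [char_zero]
  | insert j s hj ih => rw [Finset.sum_insert hj, Finset.prod_insert hj, char_add, ih]

/-- The pattern `p` moved by `v`. -/
noncomputable def shiftPattern (v : ℤ × ℤ) (p : ℤ × ℤ →₀ ZMod 2) : ℤ × ℤ →₀ ZMod 2 :=
  p.mapDomain (· + v)

theorem pairing_translate (v : ℤ × ℤ) (p : ℤ × ℤ →₀ ZMod 2) (a : X) :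
    pairing p (translate (-v.1) (-v.2) a) = pairing (shiftPattern v p) a := by
  rw [pairing, pairing, shiftPattern, Finsupp.linearCombination_mapDomain]
  congr 2
  ext z
  simp only [translate_apply, sub_neg_eq_add]
  rfl

theorem continuous_char (p : ℤ × ℤ →₀ ZMod 2) : Continuous (char p) := by
  have h : Continuous (pairing p) := by
    unfold pairing
    simp only [Finsupp.linearCombination_apply, Finsupp.sum]
    refine continuous_finsetSum _ fun z _ => ?_
    have h : Continuous fun a : X => a.1 z := (continuous_apply z).comp continuous_subtype_val
    exact (continuous_of_discreteTopology (f := fun c : ZMod 2 => p z • c)).comp h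
  exact (continuous_of_discreteTopology (f := sign)).comp h

theorem integrable_char (p : ℤ × ℤ →₀ ZMod 2) : Integrable (char p) μ :=
  (continuous_char p).integrable_of_hasCompactSupport (HasCompactSupport.of_compactSpace _)

/-! ### The group ring modulo the defining relation -/

open Polynomial

/-- The variable `t` of the function field over `ℤ/2`. -/
noncomputable def t : RatFunc (ZMod 2) := RatFunc.X

theorem t_ne_zero : t ≠ 0 := RatFunc.X_ne_zero

theorem algebraMap_one_add_X :
    algebraMap (ZMod 2)[X] (RatFunc (ZMod 2)) (1 + Polynomial.X) = 1 + t := by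
  simp [t]

theorem one_add_X_ne_zero : (1 + Polynomial.X : (ZMod 2)[X]) ≠ 0 := by
  rw [add_comm, ← C_1]
  exact X_add_C_ne_zero 1

theorem one_add_t_ne_zero : 1 + t ≠ 0 := by
  rw [← algebraMap_one_add_X]
  exact (map_ne_zero_iff _ (RatFunc.algebraMap_injective _)).2 one_add_X_ne_zero

/-- The monomial `x ^ i * y ^ j` under the substitution `x = t`, `y = 1 + t`. -/
noncomputable def mono (z : ℤ × ℤ) : RatFunc (ZMod 2) := t ^ z.1 * (1 + t) ^ z.2

theorem mono_add (z v : ℤ × ℤ) : mono (z + v) = mono z * mono v := by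
  simp only [mono, Prod.fst_add, Prod.snd_add, zpow_add₀ t_ne_zero, zpow_add₀ one_add_t_ne_zero]
  ring

theorem mono_ne_zero (z : ℤ × ℤ) : mono z ≠ 0 :=
  mul_ne_zero (zpow_ne_zero _ t_ne_zero) (zpow_ne_zero _ one_add_t_ne_zero)

/-- The Laurent polynomial `p` evaluated at `x = t`, `y = 1 + t`. -/
noncomputable def ev : (ℤ × ℤ →₀ ZMod 2) →ₗ[ZMod 2] RatFunc (ZMod 2) :=
  Finsupp.linearCombination (ZMod 2) mono

theorem ev_shiftPattern (v : ℤ × ℤ) (p : ℤ × ℤ →₀ ZMod 2) :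
    ev (shiftPattern v p) = mono v * ev p := by
  rw [ev, shiftPattern, Finsupp.linearCombination_mapDomain]
  simp only [Finsupp.linearCombination_apply, Finsupp.sum, Finset.sum_mul, Function.comp_apply,
    mono_add, mul_comm (mono v), smul_mul_assoc]

/-- A linear functional on the function field gives a point of `X`. -/
noncomputable def ofDual (f : Module.Dual (ZMod 2) (RatFunc (ZMod 2))) : X :=
  ⟨fun z => f (mono z), fun i j => by
    have h1 : mono (i + 1, j) = mono (i, j) * t := by
      rw [show ((i + 1, j) : ℤ × ℤ) = (i, j) + (1, 0) by simp, mono_add]; simp [mono]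
    have h2 : mono (i, j + 1) = mono (i, j) * (1 + t) := by
      rw [show ((i, j + 1) : ℤ × ℤ) = (i, j) + (0, 1) by simp, mono_add]; simp [mono]
    have h3 : mono (i, j) + mono (i + 1, j) + mono (i, j + 1) = 0 := by
      rw [h1, h2, show mono (i, j) + mono (i, j) * t + mono (i, j) * (1 + t)
        = mono (i, j) * (1 + t) + mono (i, j) * (1 + t) by ring]
      exact CharTwo.add_self_eq_zero _
    rw [← map_add, ← map_add, h3, map_zero]⟩

theorem pairing_ofDual (p : ℤ × ℤ →₀ ZMod 2) (f : Module.Dual (ZMod 2) (RatFunc (ZMod 2))) :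
    pairing p (ofDual f) = f (ev p) := by
  rw [ev, Finsupp.apply_linearCombination]; rfl

/-- The functional on polynomials given by the entries of `a` on the positive horizontal axis. -/
noncomputable def rowFunctional (a : X) : (ZMod 2)[X] →ₗ[ZMod 2] ZMod 2 :=
  Polynomial.lsum fun n => LinearMap.mulRight (ZMod 2) (a.1 ((n : ℤ), 0))

/-- The rule `a (i, j + 1) = a (i, j) + a (i + 1, j)` is multiplication by `1 + X` under the
functional, so the row at height `0` determines all rows above it. -/
theorem rowFunctional_monomial (a : X) (i j : ℕ) :
    rowFunctional a (Polynomial.X ^ i * (1 + Polynomial.X) ^ j) = a.1 ((i : ℤ), (j : ℤ)) := by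
  induction j generalizing i with
  | zero => simp [rowFunctional, X_pow_eq_monomial]
  | succ j ih =>
    have h := a.2 i j
    rw [pow_succ, show (Polynomial.X ^ i * ((1 + Polynomial.X) ^ j * (1 + Polynomial.X)) :
      (ZMod 2)[X]) = Polynomial.X ^ i * (1 + Polynomial.X) ^ j
        + Polynomial.X ^ (i + 1) * (1 + Polynomial.X) ^ j by ring, map_add, ih, ih]
    push_cast
    exact CharTwo.add_eq_zero.1 h

/-- With nonnegative exponents `ev p` is a genuine polynomial, and the pairing with `a` factors
through it via `rowFunctional a`. -/
theorem pairing_eq_zero_of_ev_of_nonneg {p : ℤ × ℤ →₀ ZMod 2} (hp : ev p = 0)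
    (h0 : ∀ z ∈ p.support, 0 ≤ z.1 ∧ 0 ≤ z.2) (a : X) : pairing p a = 0 := by
  set P : (ZMod 2)[X] := ∑ z ∈ p.support,
    p z • (Polynomial.X ^ z.1.toNat * (1 + Polynomial.X) ^ z.2.toNat) with hP
  have h1 : algebraMap (ZMod 2)[X] (RatFunc (ZMod 2)) P = ev p := by
    rw [hP, map_sum, ev, Finsupp.linearCombination_apply, Finsupp.sum]
    refine Finset.sum_congr rfl fun z hz => ?_
    obtain ⟨hz1, hz2⟩ := h0 z hz
    have hpz : p z = 1 := Fin.eq_one_of_ne_zero _ (Finsupp.mem_support_iff.1 hz)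
    rw [hpz, one_smul, one_smul, map_mul, map_pow, map_pow, algebraMap_one_add_X, RatFunc.algebraMap_X, mono, ← zpow_natCast, ← zpow_natCast, Int.toNat_of_nonneg hz1, Int.toNat_of_nonneg hz2]
    rfl
  have h2 : P = 0 := by
    apply RatFunc.algebraMap_injective (ZMod 2)
    rw [h1, hp, map_zero]
  have h3 : rowFunctional a P = pairing p a := by
    rw [hP, map_sum, pairing, Finsupp.linearCombination_apply, Finsupp.sum]
    refine Finset.sum_congr rfl fun z hz => ?_
    obtain ⟨hz1, hz2⟩ := h0 z hz
    rw [map_smul, rowFunctional_monomial, Int.toNat_of_nonneg hz1, Int.toNat_of_nonneg hz2]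
  rw [← h3, h2, map_zero]

theorem exists_shiftPattern_nonneg (p : ℤ × ℤ →₀ ZMod 2) :
    ∃ v : ℤ × ℤ, ∀ z ∈ (shiftPattern v p).support, 0 ≤ z.1 ∧ 0 ≤ z.2 := by
  classical
  refine ⟨(∑ z ∈ p.support, |z.1|, ∑ z ∈ p.support, |z.2|), fun z hz => ?_⟩
  obtain ⟨y, hy, rfl⟩ := Finset.mem_image.1 (Finsupp.mapDomain_support hz)
  have h1 := Finset.single_le_sum (f := fun z : ℤ × ℤ => |z.1|) (fun _ _ => abs_nonneg _) hy
  have h2 := Finset.single_le_sum (f := fun z : ℤ × ℤ => |z.2|) (fun _ _ => abs_nonneg _) hy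
  have h3 := neg_abs_le y.1
  have h4 := neg_abs_le y.2
  simp only [Prod.fst_add, Prod.snd_add] at *
  constructor <;> linarith

/-- Linear functionals separate the points of `RatFunc (ZMod 2)`, and each gives a point of `X`. For
the converse, a shift brings the pattern into the first quadrant. -/
theorem forall_pairing_eq_zero_iff (p : ℤ × ℤ →₀ ZMod 2) :
    (∀ a : X, pairing p a = 0) ↔ ev p = 0 := by
  constructor
  · intro h
    rw [← Module.forall_dual_apply_eq_zero_iff (ZMod 2)]
    intro f
    rw [← pairing_ofDual, h]
  · intro h a
    obtain ⟨v, hv⟩ := exists_shiftPattern_nonneg p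
    have h1 := pairing_eq_zero_of_ev_of_nonneg (by rw [ev_shiftPattern, h, mul_zero]) hv
      (translate v.1 v.2 a)
    rw [← pairing_translate, ← translate_inv] at h1
    rwa [show (translate v.1 v.2)⁻¹ (translate v.1 v.2 a) = a from
      (translate v.1 v.2).symm_apply_apply a] at h1

theorem integral_char (p : ℤ × ℤ →₀ ZMod 2) [Decidable (ev p = 0)] :
    ∫ a, char p a ∂μ = if ev p = 0 then 1 else 0 := by
  split_ifs with h
  · have h1 : ∀ a, char p a = 1 := fun a => by
      rw [char, (forall_pairing_eq_zero_iff p).2 h a, sign_zero]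
    simp [h1]
  · rw [← forall_pairing_eq_zero_iff] at h
    push Not at h
    obtain ⟨b, hb⟩ := h
    have hb1 : pairing p b = 1 := Fin.eq_one_of_ne_zero _ hb
    have h1 : ∀ a, char p (a + b) = -char p a := fun a => by
      rw [char, pairing_add_right, sign_add, hb1, sign_one, mul_neg_one]; rfl
    -- Invariance under translation by `b`, which flips the sign of the character, makes the
    -- integral its own negative.
    have h2 := integral_add_right_eq_self (μ := μ) (char p) b
    simp only [h1, integral_neg] at h2
    linarith

/-! ### Sets whose indicator is a combination of characters -/

/-- The linear combinations of characters. -/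
noncomputable def trigPoly : Submodule ℝ (X → ℝ) := Submodule.span ℝ (Set.range char)

theorem char_mem_trigPoly (p : ℤ × ℤ →₀ ZMod 2) : char p ∈ trigPoly :=
  Submodule.subset_span ⟨p, rfl⟩

theorem one_mem_trigPoly : (1 : X → ℝ) ∈ trigPoly := by
  have h : char 0 = 1 := funext char_zero
  rw [← h]
  exact char_mem_trigPoly 0

theorem mul_mem_trigPoly {f g : X → ℝ} (hf : f ∈ trigPoly) (hg : g ∈ trigPoly) :
    f * g ∈ trigPoly := by
  have h := Submodule.mul_mem_mul hf hg
  rw [trigPoly, Submodule.span_mul_span] at h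
  refine Submodule.span_mono ?_ h
  rintro _ ⟨_, ⟨p, rfl⟩, _, ⟨q, rfl⟩, rfl⟩
  exact ⟨p + q, funext fun a => char_add p q a⟩

theorem continuous_of_mem_trigPoly {f : X → ℝ} (hf : f ∈ trigPoly) : Continuous f := by
  induction hf using Submodule.span_induction with
  | mem f hf => obtain ⟨p, rfl⟩ := hf; exact continuous_char p
  | zero => exact continuous_zero
  | add f g _ _ hf hg => exact hf.add hg
  | smul c f _ hf => exact hf.const_smul c

/-- The sets whose indicator function is a linear combination of characters. -/
def trigSets : Set (Set X) := {A | A.indicator (fun _ => (1 : ℝ)) ∈ trigPoly}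

theorem isSetAlgebra_trigSets : IsSetAlgebra trigSets where
  empty_mem := by
    rw [trigSets, Set.mem_ofPred_eq, Set.indicator_empty]
    exact trigPoly.zero_mem
  compl_mem A hA := by
    have h := trigPoly.sub_mem one_mem_trigPoly hA
    rw [trigSets, Set.mem_ofPred_eq, Set.indicator_compl]
    exact h
  union_mem A B hA hB := by
    have h := trigPoly.sub_mem (trigPoly.add_mem hA hB) (mul_mem_trigPoly hA hB)
    rw [trigSets, Set.mem_ofPred_eq]
    convert h using 1
    ext a
    by_cases h1 : a ∈ A <;> by_cases h2 : a ∈ B <;> simp [h1, h2]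

/-- The indicator is `(1 + sign c * sign (a z)) / 2`. -/
theorem cylinder_mem_trigSets (z : ℤ × ℤ) (c : ZMod 2) : {a : X | a.1 z = c} ∈ trigSets := by
  have h := trigPoly.add_mem (trigPoly.smul_mem (1 / 2 : ℝ) one_mem_trigPoly)
    (trigPoly.smul_mem (sign c / 2) (char_mem_trigPoly (Finsupp.single z 1)))
  rw [trigSets, Set.mem_ofPred_eq]
  convert h using 1
  ext a
  have h2 : ∀ c : ZMod 2, c = 0 ∨ c = 1 := by decide
  simp only [Set.indicator, Set.mem_ofPred_eq, Pi.add_apply, Pi.smul_apply, Pi.one_apply, char,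
    pairing_single, smul_eq_mul]
  rcases h2 c with rfl | rfl <;> rcases h2 (a.1 z) with h | h <;>
    norm_num [h, sign_zero, sign_one]

theorem measurableSpace_eq_generateFrom_trigSets :
    (inferInstance : MeasurableSpace X) = MeasurableSpace.generateFrom trigSets := by
  apply le_antisymm
  · refine Measurable.comap_le (m₁ := MeasurableSpace.generateFrom trigSets) ?_
    refine @measurable_pi_lambda _ _ _ (MeasurableSpace.generateFrom trigSets) _ _ fun z => ?_
    refine @measurable_to_countable' _ _ _ _ (MeasurableSpace.generateFrom trigSets) _ fun c => ?_
    exact MeasurableSpace.measurableSet_generateFrom (cylinder_mem_trigSets z c)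
  · refine MeasurableSpace.generateFrom_le fun A hA => ?_
    exact (measurable_indicator_const_iff (1 : ℝ)).1 (continuous_of_mem_trigPoly hA).measurable

theorem measureDense_trigSets : μ.MeasureDense trigSets :=
  .of_generateFrom_isSetAlgebra_finite _ isSetAlgebra_trigSets
    measurableSpace_eq_generateFrom_trigSets

/-! ### Mixing of several shifts at once -/

section Mixing

variable {I κ : Type*} [Fintype κ] {l : Filter I} {v : I → κ → ℤ × ℤ}

/-- The product is the character of a single pattern with value `∑ j, mono (v i j) * ev (p j)`.
Either all `ev (p j)` vanish and both sides are `1`, or `hv` makes the integral eventually `0`, as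
is the limit. -/
theorem tendsto_integral_prod_char
    (hv : ∀ P : κ → RatFunc (ZMod 2), P ≠ 0 → ∀ᶠ i in l, ∑ j, mono (v i j) * P j ≠ 0)
    (p : κ → ℤ × ℤ →₀ ZMod 2) :
    Tendsto (fun i => ∫ a, ∏ j, char (p j) (translate (-(v i j).1) (-(v i j).2) a) ∂μ) l
      (𝓝 (∏ j, ∫ a, char (p j) a ∂μ)) := by
  classical
  have h1 : ∀ i a, ∏ j, char (p j) (translate (-(v i j).1) (-(v i j).2) a)
      = char (∑ j, shiftPattern (v i j) (p j)) a := fun i a => by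
    rw [char_sum]
    exact Finset.prod_congr rfl fun j _ => congrArg sign (pairing_translate _ _ _)
  simp only [h1, integral_char, map_sum, ev_shiftPattern]
  by_cases h2 : (fun j => ev (p j)) = 0
  · have h3 : ∀ j, ev (p j) = 0 := fun j => congrFun h2 j
    simpa [h3] using tendsto_const_nhds
  · obtain ⟨j, hj⟩ := Function.ne_iff.1 h2
    have h4 : ∏ j, (if ev (p j) = 0 then 1 else 0 : ℝ) = 0 :=
      Finset.prod_eq_zero (Finset.mem_univ j) (if_neg hj)
    rw [h4]
    exact tendsto_const_nhds.congr' ((hv _ h2).mono fun i hi => (if_neg hi).symm)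

theorem tendsto_integral_prod_trigPoly
    (hv : ∀ P : κ → RatFunc (ZMod 2), P ≠ 0 → ∀ᶠ i in l, ∑ j, mono (v i j) * P j ≠ 0)
    {f : κ → X → ℝ} (hf : ∀ j, f j ∈ trigPoly) :
    Tendsto (fun i => ∫ a, ∏ j, f j (translate (-(v i j).1) (-(v i j).2) a) ∂μ) l
      (𝓝 (∏ j, ∫ a, f j a ∂μ)) := by
  classical
  simp only [trigPoly, Finsupp.mem_span_range_iff_exists_finsupp] at hf
  choose c hc using hf
  have h1 : ∀ j a, f j a = ∑ p ∈ (c j).support, c j p * char p a := fun j a => by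
    rw [← hc j, Finsupp.sum, Finset.sum_apply]; rfl
  have h2 : ∀ j, ∫ a, f j a ∂μ = ∑ p ∈ (c j).support, c j p * ∫ a, char p a ∂μ := fun j => by
    simp only [h1]
    rw [integral_finsetSum _ fun p _ => (integrable_char p).const_mul _]
    simp only [integral_const_mul]
  have h3 : ∀ i, ∫ a, ∏ j, f j (translate (-(v i j).1) (-(v i j).2) a) ∂μ
      = ∑ x ∈ Fintype.piFinset fun j => (c j).support,
        (∏ j, c j (x j)) * ∫ a, ∏ j, char (x j) (translate (-(v i j).1) (-(v i j).2) a) ∂μ :=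
    fun i => by
      simp only [h1, Finset.prod_univ_sum, Finset.prod_mul_distrib]
      rw [integral_finsetSum]
      · simp only [integral_const_mul]
      · intro x _
        refine Integrable.const_mul (Continuous.integrable_of_hasCompactSupport ?_
          (HasCompactSupport.of_compactSpace _)) _
        exact continuous_finsetProd _ fun j _ =>
          (continuous_char _).comp (translate _ _).continuous
  simp only [h2, h3, Finset.prod_univ_sum, Finset.prod_mul_distrib]
  exact tendsto_finsetSum _ fun x _ => (tendsto_integral_prod_char hv x).const_mul _

theorem tendsto_measureReal_iInter_of_mem_trigSets
    (hv : ∀ P : κ → RatFunc (ZMod 2), P ≠ 0 → ∀ᶠ i in l, ∑ j, mono (v i j) * P j ≠ 0)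
    {A : κ → Set X} (hA : ∀ j, A j ∈ trigSets) :
    Tendsto (fun i => μ.real (⋂ j, translate (-(v i j).1) (-(v i j).2) ⁻¹' A j)) l
      (𝓝 (∏ j, μ.real (A j))) := by
  have hm : ∀ j, MeasurableSet (A j) := fun j => measureDense_trigSets.measurable _ (hA j)
  have h1 := tendsto_integral_prod_trigPoly hv hA
  simp only [integral_indicator_const _ (hm _), smul_eq_mul, mul_one] at h1
  refine h1.congr fun i => ?_
  have h2 : MeasurableSet (⋂ j, translate (-(v i j).1) (-(v i j).2) ⁻¹' A j) :=
    .iInter fun j => (translate _ _).continuous.measurable (hm j)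
  rw [← mul_one (μ.real _), ← smul_eq_mul, ← integral_indicator_const _ h2]
  refine integral_congr_ae (.of_forall fun a => ?_)
  classical
  simp only [Set.indicator_apply, Finset.prod_ite_zero, Finset.prod_const_one, Set.mem_iInter,
    Set.mem_preimage, Finset.mem_univ, true_imp_iff]

theorem abs_measureReal_sub_le_symmDiff {Ω : Type*} [MeasurableSpace Ω] {ν : Measure Ω}
    [IsFiniteMeasure ν] (A B : Set Ω) : |ν.real A - ν.real B| ≤ ν.real (symmDiff A B) := by
  have h : ∀ A B : Set Ω, ν.real A ≤ ν.real B + ν.real (symmDiff A B) := fun A B =>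
    (measureReal_mono (fun x hx => by
      by_cases hB : x ∈ B
      · exact .inl hB
      · exact .inr (.inl ⟨hx, hB⟩))).trans (measureReal_union_le _ _)
  have h1 := h A B
  have h2 := h B A
  rw [symmDiff_comm] at h2
  rw [abs_le]
  constructor <;> linarith

/-- Telescoping, one factor exchanged at a time. -/
theorem abs_prod_sub_prod_le {ι : Type*} (s : Finset ι) {x y : ι → ℝ}
    (hx : ∀ j, |x j| ≤ 1) (hy : ∀ j, |y j| ≤ 1) :
    |∏ j ∈ s, x j - ∏ j ∈ s, y j| ≤ ∑ j ∈ s, |x j - y j| := by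
  classical
  induction s using Finset.induction_on with
  | empty => simp
  | insert j s hj ih =>
    rw [Finset.prod_insert hj, Finset.prod_insert hj, Finset.sum_insert hj,
      show x j * ∏ j ∈ s, x j - y j * ∏ j ∈ s, y j
        = (x j - y j) * ∏ j ∈ s, x j + y j * (∏ j ∈ s, x j - ∏ j ∈ s, y j) by ring]
    refine (abs_add_le _ _).trans (add_le_add ?_ ?_)
    · rw [abs_mul, Finset.abs_prod]
      exact mul_le_of_le_one_right (abs_nonneg _)
        (Finset.prod_le_one (fun _ _ => abs_nonneg _) fun j _ => hx j)
    · rw [abs_mul]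
      exact (mul_le_of_le_one_left (abs_nonneg _) (hy j)).trans ih

theorem symmDiff_iInter_subset {Ω ι : Type*} (A B : ι → Set Ω) :
    symmDiff (⋂ j, A j) (⋂ j, B j) ⊆ ⋃ j, symmDiff (A j) (B j) := by
  intro x hx
  simp only [Set.mem_symmDiff, Set.mem_iInter, Set.mem_iUnion, not_forall] at hx ⊢
  rcases hx with ⟨h, j, hj⟩ | ⟨h, j, hj⟩
  · exact ⟨j, .inl ⟨h j, hj⟩⟩
  · exact ⟨j, .inr ⟨h j, hj⟩⟩

theorem tendsto_measureReal_iInter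
    (hv : ∀ P : κ → RatFunc (ZMod 2), P ≠ 0 → ∀ᶠ i in l, ∑ j, mono (v i j) * P j ≠ 0)
    {A : κ → Set X} (hA : ∀ j, MeasurableSet (A j)) :
    Tendsto (fun i => μ.real (⋂ j, translate (-(v i j).1) (-(v i j).2) ⁻¹' A j)) l
      (𝓝 (∏ j, μ.real (A j))) := by
  rw [Metric.tendsto_nhds]
  intro ε hε
  -- A third of `ε` each goes to the limit, to the intersection and to the convergence for the
  -- approximating sets; the `+ 1` covers empty `κ`.
  set δ : ℝ := ε / (3 * (Fintype.card κ + 1)) with hδ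
  have hδ0 : 0 < δ := by positivity
  have hδε : (Fintype.card κ : ℝ) * δ ≤ ε / 3 := by
    rw [hδ, mul_div_assoc', div_le_div_iff₀ (by positivity) (by positivity)]
    nlinarith
  choose B hB hAB using fun j => measureDense_trigSets.approx (A j) (hA j) (measure_ne_top _ _) δ hδ0
  have hm : ∀ j, MeasurableSet (B j) := fun j => measureDense_trigSets.measurable _ (hB j)
  have hAB' : ∀ j, μ.real (symmDiff (A j) (B j)) ≤ δ := fun j =>
    ENNReal.toReal_le_of_le_ofReal hδ0.le (hAB j).le
  have hsum : ∑ j, μ.real (symmDiff (A j) (B j)) ≤ ε / 3 := by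
    refine (Finset.sum_le_sum fun j _ => hAB' j).trans ?_
    simpa using hδε
  have h1 : |∏ j, μ.real (B j) - ∏ j, μ.real (A j)| ≤ ε / 3 := by
    rw [abs_sub_comm]
    refine (abs_prod_sub_prod_le _ (fun j => ?_) fun j => ?_).trans
      ((Finset.sum_le_sum fun j _ => abs_measureReal_sub_le_symmDiff _ _).trans hsum)
    all_goals rw [abs_of_nonneg measureReal_nonneg]; exact measureReal_le_one
  have h2 : ∀ i, |μ.real (⋂ j, translate (-(v i j).1) (-(v i j).2) ⁻¹' A j)
      - μ.real (⋂ j, translate (-(v i j).1) (-(v i j).2) ⁻¹' B j)| ≤ ε / 3 := fun i => by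
    refine (abs_measureReal_sub_le_symmDiff _ _).trans ?_
    refine (measureReal_mono (symmDiff_iInter_subset _ _)).trans ?_
    refine (measureReal_iUnion_fintype_le _).trans (le_of_eq_of_le ?_ hsum)
    refine Finset.sum_congr rfl fun j _ => ?_
    rw [← Set.preimage_symmDiff]
    exact (measurePreserving_translate _ _).measureReal_preimage
      ((hA j).symmDiff (hm j)).nullMeasurableSet
  filter_upwards [Metric.tendsto_nhds.1 (tendsto_measureReal_iInter_of_mem_trigSets hv hB)
    (ε / 3) (by positivity)] with i hi
  rw [Real.dist_eq] at hi ⊢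
  have h3 := h2 i
  rw [abs_le] at h1 h3
  rw [abs_lt] at hi ⊢
  constructor <;> linarith

theorem tendsto_measure_iInter
    (hv : ∀ P : κ → RatFunc (ZMod 2), P ≠ 0 → ∀ᶠ i in l, ∑ j, mono (v i j) * P j ≠ 0)
    {A : κ → Set X} (hA : ∀ j, MeasurableSet (A j)) :
    Tendsto (fun i => μ (⋂ j, translate (-(v i j).1) (-(v i j).2) ⁻¹' A j)) l
      (𝓝 (∏ j, μ (A j))) := by
  rw [← ENNReal.tendsto_toReal_iff (fun _ => measure_ne_top _ _)
    (ENNReal.prod_ne_top fun _ _ => measure_ne_top _ _), ENNReal.toReal_prod]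
  exact tendsto_measureReal_iInter hv hA

end Mixing

/-! ### Linear independence of shifted patterns -/

theorem algebraMap_monomial (i j : ℕ) :
    algebraMap (ZMod 2)[X] (RatFunc (ZMod 2)) (Polynomial.X ^ i * (1 + Polynomial.X) ^ j)
      = mono (i, j) := by
  rw [map_mul, map_pow, map_pow, algebraMap_one_add_X, RatFunc.algebraMap_X, mono, zpow_natCast,
    zpow_natCast]
  rfl

theorem natDegree_monomial (i j : ℕ) :
    (Polynomial.X ^ i * (1 + Polynomial.X) ^ j : (ZMod 2)[X]).natDegree = i + j := by
  rw [natDegree_mul (pow_ne_zero _ X_ne_zero) (pow_ne_zero _ one_add_X_ne_zero), natDegree_pow,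
    natDegree_pow, natDegree_X, add_comm 1 Polynomial.X, ← C_1, natDegree_X_add_C, mul_one, mul_one]

theorem natTrailingDegree_monomial (i j : ℕ) :
    (Polynomial.X ^ i * (1 + Polynomial.X) ^ j : (ZMod 2)[X]).natTrailingDegree = i := by
  have h : ((1 + Polynomial.X) ^ j : (ZMod 2)[X]).natTrailingDegree = 0 :=
    natTrailingDegree_eq_zero.2 (.inr (by simp [coeff_zero_eq_eval_zero]))
  rw [mul_comm, natTrailingDegree_mul_X_pow (pow_ne_zero _ one_add_X_ne_zero), h, zero_add]

/-- Once the exponents are made nonnegative by a common shift, the trailing degree recovers the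
first and the degree their sum. -/
theorem mono_injective : Function.Injective mono := by
  intro z z' h
  obtain ⟨v, a, b, a', b', h1, h2⟩ : ∃ (v : ℤ × ℤ) (a b a' b' : ℕ),
      z + v = (↑a, ↑b) ∧ z' + v = (↑a', ↑b') := by
    refine ⟨(|z.1| + |z'.1|, |z.2| + |z'.2|), (z.1 + (|z.1| + |z'.1|)).toNat,
      (z.2 + (|z.2| + |z'.2|)).toNat, (z'.1 + (|z.1| + |z'.1|)).toNat,
      (z'.2 + (|z.2| + |z'.2|)).toNat, ?_⟩
    constructor <;> ext <;> simp <;> grind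
  have h3 : mono (a, b) = mono (a', b') := by rw [← h1, ← h2, mono_add, mono_add, h]
  rw [← algebraMap_monomial, ← algebraMap_monomial] at h3
  have h4 := RatFunc.algebraMap_injective _ h3
  have h5 := congrArg natTrailingDegree h4
  have h6 := congrArg natDegree h4
  rw [natTrailingDegree_monomial, natTrailingDegree_monomial] at h5
  rw [natDegree_monomial, natDegree_monomial] at h6
  have h7 : b = b' := by omega
  rw [h5, h7, ← h2] at h1
  exact add_right_cancel h1

theorem mono_zero : mono 0 = 1 := by simp [mono]

/-- If `P 1 ≠ 0`, injectivity of `mono` leaves at most one bad `g`. The coordinates of `g` are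
swapped because `S`, whose exponent is `g.1`, is the vertical shift. -/
theorem eventually_pair_ne_zero (P : Fin 2 → RatFunc (ZMod 2)) (hP : P ≠ 0) :
    ∀ᶠ g : ℤ × ℤ in cofinite, ∑ j, mono ((![0, (g.2, g.1)] : Fin 2 → ℤ × ℤ) j) * P j ≠ 0 := by
  simp only [Fin.sum_univ_two, Matrix.cons_val_zero, Matrix.cons_val_one, mono_zero, one_mul]
  by_cases h1 : P 1 = 0
  · refine .of_forall fun g hg => hP ?_
    rw [h1, mul_zero, add_zero] at hg
    ext j
    fin_cases j
    · exact hg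
    · exact h1
  · refine (Set.Subsingleton.finite fun g hg g' hg' => ?_ :
      {g : ℤ × ℤ | ¬ P 0 + mono (g.2, g.1) * P 1 ≠ 0}.Finite)
    simp only [Set.mem_ofPred_eq, not_not] at hg hg'
    have h2 := mono_injective (mul_right_cancel₀ h1 (add_left_cancel (hg.trans hg'.symm)))
    simp only [Prod.mk.injEq] at h2
    exact Prod.ext h2.2 h2.1

/-- The two summands have no exponent in common. -/
theorem eq_zero_of_X_pow_mul_add {R : Type*} [CommRing R] {n : ℕ} {u r : R[X]}
    (hr : r.natDegree < n) (h : Polynomial.X ^ n * u + r = 0) : u = 0 ∧ r = 0 := by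
  have h1 : r = 0 := by
    ext i
    rw [coeff_zero]
    rcases lt_or_ge i n with hi | hi
    · have h2 := congrArg (coeff · i) h
      simpa [coeff_X_pow_mul', hi.not_ge] using h2
    · exact coeff_eq_zero_of_natDegree_lt (hr.trans_le hi)
  rw [h1, add_zero] at h
  refine ⟨Polynomial.ext fun i => ?_, h1⟩
  rw [← coeff_X_pow_mul u n i, h, coeff_zero, coeff_zero]

theorem one_add_t_pow_two_pow (m : ℕ) : (1 + t) ^ 2 ^ m = 1 + t ^ 2 ^ m := by
  rw [add_pow_char_pow, one_pow]

theorem eventually_triple_ne_zero (P : Fin 3 → RatFunc (ZMod 2)) (hP : P ≠ 0) :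
    ∀ᶠ m : ℕ in atTop,
      ∑ j, mono ((![0, (0, -2 ^ m), (-2 ^ m, 0)] : Fin 3 → ℤ × ℤ) j) * P j ≠ 0 := by
  -- A common denominator `d` replaces the `P j` by polynomials `p j` whose degrees are independent
  -- of `m`.
  obtain ⟨d, hd⟩ := IsLocalization.exist_integer_multiples_of_finite
    (nonZeroDivisors (ZMod 2)[X]) P
  choose p hp using hd
  have hd0 : algebraMap (ZMod 2)[X] (RatFunc (ZMod 2)) d ≠ 0 :=
    (map_ne_zero_iff _ (RatFunc.algebraMap_injective _)).2 (nonZeroDivisors.ne_zero d.2)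
  filter_upwards [eventually_gt_atTop ((p 0 + p 1 + p 2).natDegree + (p 2).natDegree
    + (p 0 + p 1).natDegree)] with m hm hsum
  have hmn : m < 2 ^ m := Nat.lt_two_pow_self
  simp only [Fin.sum_univ_three, Matrix.cons_val, mono_zero, one_mul] at hsum
  have h1 : t ^ 2 ^ m ≠ 0 := pow_ne_zero _ t_ne_zero
  have h2 : 1 + t ^ 2 ^ m ≠ 0 := by
    rw [← one_add_t_pow_two_pow]; exact pow_ne_zero _ one_add_t_ne_zero
  have h3 : mono (0, -2 ^ m) = (1 + t ^ 2 ^ m)⁻¹ := by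
    rw [mono, zpow_zero, one_mul, zpow_neg, ← one_add_t_pow_two_pow]; norm_cast
  have h4 : mono (-2 ^ m, 0) = (t ^ 2 ^ m)⁻¹ := by
    rw [mono, zpow_zero, mul_one, zpow_neg]; norm_cast
  rw [h3, h4] at hsum
  have h5 : t ^ 2 ^ m * (1 + t ^ 2 ^ m) * P 0 + t ^ 2 ^ m * P 1 + (1 + t ^ 2 ^ m) * P 2 = 0 := by
    field_simp at hsum
    linear_combination hsum
  -- The relation in base `q = X ^ 2 ^ m` has digits `p 0`, `p 0 + p 1 + p 2`, `p 2`; the lower two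
  -- have degree less than `2 ^ m` by the choice of `m`, so they can be split off one after the
  -- other.
  have h6 : (Polynomial.X ^ 2 ^ m * (Polynomial.X ^ 2 ^ m * p 0 + (p 0 + p 1 + p 2)) + p 2 :
      (ZMod 2)[X]) = 0 := by
    apply RatFunc.algebraMap_injective (ZMod 2)
    simp only [map_add, map_mul, map_pow, map_zero, hp, Algebra.smul_def, RatFunc.algebraMap_X,
      show RatFunc.X = t from rfl]
    linear_combination (algebraMap (ZMod 2)[X] (RatFunc (ZMod 2)) d) * h5
  obtain ⟨h7, h8⟩ := eq_zero_of_X_pow_mul_add (by omega) h6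
  obtain ⟨h9, h10⟩ := eq_zero_of_X_pow_mul_add (by omega) h7
  rw [h9, h8, zero_add, add_zero] at h10
  apply hP
  ext j
  have h11 : p j = 0 := by fin_cases j <;> assumption
  have h12 := hp j
  rw [h11, map_zero, Algebra.smul_def] at h12
  exact (mul_eq_zero.1 h12.symm).resolve_left hd0

/-! ### The main properties of the action -/

theorem isMixingAction_shifts : IsMixingAction μ S T := by
  intro A B hA hB
  have h := tendsto_measure_iInter eventually_pair_ne_zero (A := ![A, B])
    (by intro j; fin_cases j <;> assumption)
  rw [Fin.prod_univ_two] at h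
  refine h.congr fun g => ?_
  rw [S_zpow, T_zpow, translate_mul, translate_image]
  congr 1
  ext a
  simp [Set.mem_iInter, Fin.forall_fin_two, translate_zero]

theorem tendsto_measure_triple {A B C : Set X} (hA : MeasurableSet A) (hB : MeasurableSet B)
    (hC : MeasurableSet C) :
    Tendsto (fun m : ℕ => μ (A ∩ (S ^ (-(2 ^ m : ℤ))) '' B ∩ (T ^ (-(2 ^ m : ℤ))) '' C))
      atTop (𝓝 (μ A * μ B * μ C)) := by
  have h := tendsto_measure_iInter eventually_triple_ne_zero (A := ![A, B, C])
    (by intro j; fin_cases j <;> assumption)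
  rw [Fin.prod_univ_three] at h
  refine h.congr fun m => ?_
  rw [S_zpow, T_zpow, translate_image, translate_image]
  congr 1
  ext a
  simp [Set.mem_iInter, Fin.forall_fin_succ, translate_zero, and_assoc]

/-- The Frobenius image of the defining relation: `1 + t ^ 2 ^ m + (1 + t) ^ 2 ^ m = 0`. -/
theorem apply_zero_add_apply_two_pow (a : X) (m : ℕ) :
    a.1 (0, 0) + a.1 (2 ^ m, 0) + a.1 (0, 2 ^ m) = 0 := by
  have h := (forall_pairing_eq_zero_iff (Finsupp.single (0, 0) 1 + Finsupp.single (2 ^ m, 0) 1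
    + Finsupp.single (0, 2 ^ m) 1)).2 ?_ a
  · simpa only [pairing_add_left, pairing_single] using h
  · have h1 : t ^ (2 ^ m : ℤ) = t ^ 2 ^ m := by norm_cast
    have h2 : (1 + t) ^ (2 ^ m : ℤ) = (1 + t) ^ 2 ^ m := by norm_cast
    simp only [ev, map_add, Finsupp.linearCombination_single, one_smul, mono, zpow_zero, one_mul,
      mul_one, h1, h2, one_add_t_pow_two_pow]
    exact CharTwo.add_self_eq_zero _

/-- The points of `X` with entry `1` at the origin. -/
def oneAtOrigin : Set X := {a | a.1 (0, 0) = 1}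

theorem measurableSet_oneAtOrigin : MeasurableSet oneAtOrigin :=
  measureDense_trigSets.measurable _ (cylinder_mem_trigSets _ _)

theorem measure_oneAtOrigin : μ oneAtOrigin = 1 / 2 := by
  have h1 : ∀ a : X, oneAtOrigin.indicator (fun _ => (1 : ℝ)) a
      = 1 / 2 - 1 / 2 * char (Finsupp.single (0, 0) 1) a := fun a => by
    have h2 : ∀ c : ZMod 2, c = 0 ∨ c = 1 := by decide
    simp only [Set.indicator, oneAtOrigin, Set.mem_ofPred_eq, char, pairing_single]
    rcases h2 (a.1 (0, 0)) with h | h <;> norm_num [h, sign_zero, sign_one]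
  have h2 : μ.real oneAtOrigin = 1 / 2 := by
    classical
    rw [← mul_one (μ.real _), ← smul_eq_mul,
      ← integral_indicator_const _ measurableSet_oneAtOrigin]
    simp only [h1]
    rw [integral_sub (integrable_const _) ((integrable_char _).const_mul _), integral_const_mul,
      integral_char, if_neg]
    · simp
    · simp [ev, mono_ne_zero]
  rw [← ENNReal.ofReal_toReal (measure_ne_top μ oneAtOrigin)]
  change ENNReal.ofReal (μ.real oneAtOrigin) = 1 / 2
  rw [h2, ENNReal.ofReal_div_of_pos two_pos]
  simp

theorem oneAtOrigin_inter_eq_empty (m : ℕ) :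
    oneAtOrigin ∩ (S ^ (2 ^ m : ℤ)) '' oneAtOrigin ∩ (T ^ (2 ^ m : ℤ)) '' oneAtOrigin = ∅ := by
  rw [S_zpow, T_zpow, translate_image, translate_image, Set.eq_empty_iff_forall_notMem]
  rintro a ⟨⟨h1, h2⟩, h3⟩
  simp only [oneAtOrigin, Set.mem_preimage, Set.mem_ofPred_eq, translate_apply, neg_zero, sub_zero,
    sub_neg_eq_add, zero_add] at h1 h2 h3
  have h := apply_zero_add_apply_two_pow a m
  rw [h1, h2, h3] at h
  exact absurd h (by decide)

end Ledrappier

open Ledrappier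
/-- `S ^ k '' A` is the image `S^k A`; the sequence is `n_m = 2 ^ m`. -/
theorem mainTheorem1 :
    -- commuting measure-preserving transformations of the compact group with Haar measure
    Commute S T ∧ MeasurePreserving S μ μ ∧ MeasurePreserving T μ μ ∧
    -- the action which they generate is mixing
    IsMixingAction μ S T ∧
    -- it is 3-fold mixing along the pair of sequences `(-n_m, 0)`, `(0, -n_m)`
    (∀ A B C : Set X, MeasurableSet A → MeasurableSet B → MeasurableSet C →
      Tendsto (fun m : ℕ =>
          μ (A ∩ (S ^ (-(2 ^ m : ℤ))) '' B ∩ (T ^ (-(2 ^ m : ℤ))) '' C))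
        atTop (𝓝 (μ A * μ B * μ C))) ∧
    (∀ A : Set X, MeasurableSet A →
      Tendsto (fun m : ℕ =>
          μ (A ∩ (S ^ (-(2 ^ m : ℤ))) '' A ∩ (T ^ (-(2 ^ m : ℤ))) '' A))
        atTop (𝓝 (μ A ^ 3))) ∧
    -- in the opposite direction there is a set of measure `1/2` with empty triple intersections
    (∃ A₀ : Set X, MeasurableSet A₀ ∧ μ A₀ = 1 / 2 ∧
      ∀ m : ℕ, μ (A₀ ∩ (S ^ (2 ^ m : ℤ)) '' A₀ ∩ (T ^ (2 ^ m : ℤ)) '' A₀) = 0) ∧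
    -- so the inverse action, generated by `S⁻¹` and `T⁻¹`, is not 3-fold mixing along them
    ¬ (∀ A : Set X, MeasurableSet A →
      Tendsto (fun m : ℕ =>
          μ (A ∩ (S⁻¹ ^ (-(2 ^ m : ℤ))) '' A ∩ (T⁻¹ ^ (-(2 ^ m : ℤ))) '' A))
        atTop (𝓝 (μ A ^ 3))) := by
  have h0 : ∀ m : ℕ, μ (oneAtOrigin ∩ (S ^ (2 ^ m : ℤ)) '' oneAtOrigin
      ∩ (T ^ (2 ^ m : ℤ)) '' oneAtOrigin) = 0 := fun m => by
    rw [oneAtOrigin_inter_eq_empty, measure_empty]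
  refine ⟨?_, measurePreserving_translate 0 1, measurePreserving_translate 1 0,
    isMixingAction_shifts, fun A B C hA hB hC => tendsto_measure_triple hA hB hC,
    fun A hA => ?_, ⟨oneAtOrigin, measurableSet_oneAtOrigin, measure_oneAtOrigin, h0⟩,
    fun h => ?_⟩
  · rw [Commute, SemiconjBy, S, T, translate_mul, translate_mul, add_comm 0, add_comm 1]
  · rw [pow_succ, sq]
    exact tendsto_measure_triple hA hA hA
  · have h1 := h oneAtOrigin measurableSet_oneAtOrigin
    -- Inverting the generators cancels the minus sign, so the sequence is constantly `0`, whereas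
    -- the claimed limit is `(1 / 2) ^ 3`.
    simp only [inv_zpow', neg_neg, h0] at h1
    have h2 := tendsto_nhds_unique h1 tendsto_const_nhds
    rw [measure_oneAtOrigin] at h2
    simp at h2
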